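/- Let $V$ and $E$ be disjoint finite sets (of vertices and edges) and let $\iota : V\times E\to\mathbb{Z}_{\ge 0}$ be a function. An incidence is a triple $(v,e,k)$ with $1\le k\le\iota(v,e)$; it contains $v$ and $e$. Write $\mathcal I$ for the set of incidences. An oriented hypergraph $G=(V,E,\mathcal I,\sigma)$ is given by this data together with an arbitrary function $\sigma:\mathcal I\to\{+1,-1\}$. A path in $G$ is an alternating sequence $a_0,i_1,a_1,\dots,i_m,a_m$ in which the $a_j$ are alternately vertices and edges, $i_j$ is an incidence containing $a_{j-1}$ and $a_j$, and no vertex, edge or incidence is repeated; its end-points are $a_0$ and $a_m$. A circle of length $k\ge 1$ is a sequence $a_0,i_1,a_1,\dots,i_{2k},a_{2k}$ of the same kind with no repetition except $a_0=a_{2k}$; its sign is $(-1)^k\prod_{h=1}^{2k}\sigma(i_h)$. $G$ is balanced if every circle has sign $+1$, and $G$ is balanceable if there is a set of incidences such that negating $\sigma$ on exactly these incidences yields a balanced oriented hypergraph. A cross-theta in $G$ consists of a vertex $v$, an edge $e$ and three paths in $G$, each with end-points $v$ and $e$, any two of which have no vertex or edge other than $v$ and $e$, and no incidence, in common. Theorem.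 An oriented hypergraph $G$ is balanceable if and only if it contains no cross-theta. -/

import Mathlib

/-- A hypergraph with multiple incidences, given by its incidence function: `mult v e` is the
multiplicity of the incidence of the vertex `v` with the edge `e`, and `v` and `e` are
incident when it is nonzero. -/
structure MultiHypergraph (V E : Type*) where
  mult : V → E → ℕ

namespace MultiHypergraph

variable {V E : Type*}

/-- An incidence is a triple `(v, e, k)`, where `k` is one of `mult v e` labels. -/
structure Incidence (H : MultiHypergraph V E) where
  vertex : V
  edge : E
  label : Fin (H.mult vertex edge)

variable {H : MultiHypergraph V E}

/-- The incidence `i` contains the two elements `a` and `b`, one of which is its vertex and the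
other its edge. Consecutive terms of a sequence linked in this way thus alternate between
vertices and edges. -/
def Incidence.Joins (i : H.Incidence) (a b : V ⊕ E) : Prop :=
  (a = Sum.inl i.vertex ∧ b = Sum.inr i.edge) ∨ (a = Sum.inr i.edge ∧ b = Sum.inl i.vertex)

/-- A path `a₀, i₁, a₁, …, iₘ, aₘ`: an alternating sequence of vertices and edges `aⱼ`, with
incidences `iⱼ` containing `aⱼ₋₁` and `aⱼ`, where no vertex, edge or incidence is repeated. -/
structure Path (H : MultiHypergraph V E) where
  length : ℕ
  elt : Fin (length + 1) → V ⊕ E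
  inc : Fin length → H.Incidence
  joins : ∀ j : Fin length, (inc j).Joins (elt j.castSucc) (elt j.succ)
  elt_injective : Function.Injective elt
  inc_injective : Function.Injective inc

namespace Path

/-- The vertices and edges of the path. -/
def elements (P : H.Path) : Set (V ⊕ E) := Set.range P.elt

/-- The vertices and edges of the path other than its two end-points. -/
def interior (P : H.Path) : Set (V ⊕ E) :=
  {a | ∃ j : Fin (P.length + 1), j ≠ 0 ∧ j ≠ Fin.last P.length ∧ P.elt j = a}

/-- The incidences of the path. -/
def incidences (P : H.Path) : Set H.Incidence := Set.range P.inc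

/-- Two paths are internally disjoint if they have nothing in common except possibly
end-points of both. In particular they share no incidence. -/
def InternallyDisjoint (P Q : H.Path) : Prop :=
  Disjoint P.interior Q.elements ∧ Disjoint P.elements Q.interior ∧
    Disjoint P.incidences Q.incidences

end Path

/-- A circle of length `k ≥ 1`: an alternating sequence `a₀, i₁, a₁, …, i₂ₖ, a₂ₖ` of vertices
and edges `aⱼ`, with incidences `iⱼ` containing `aⱼ₋₁` and `aⱼ`, where no vertex, edge or
incidence is repeated except that `a₀ = a₂ₖ`. -/
structure Circle (H : MultiHypergraph V E) where
  length : ℕ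
  length_pos : 0 < length
  elt : Fin (2 * length + 1) → V ⊕ E
  inc : Fin (2 * length) → H.Incidence
  joins : ∀ j : Fin (2 * length), (inc j).Joins (elt j.castSucc) (elt j.succ)
  closed : elt 0 = elt (Fin.last (2 * length))
  elt_injective : Function.Injective fun j : Fin (2 * length) => elt j.castSucc
  inc_injective : Function.Injective inc

/-- The three paths `P 0`, `P 1`, `P 2` form a theta graph with end-points `a` and `b`. -/
structure IsTheta (P : Fin 3 → H.Path) (a b : V ⊕ E) : Prop where
  endpoints_ne : a ≠ b
  first_eq : ∀ t, (P t).elt 0 = a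
  last_eq : ∀ t, (P t).elt (Fin.last (P t).length) = b
  internallyDisjoint : ∀ s t, s ≠ t → (P s).InternallyDisjoint (P t)

/-- The hypergraph contains a cross-theta: a theta graph one of whose end-points is a vertex
while the other is an edge. -/
def ContainsCrossTheta (H : MultiHypergraph V E) : Prop :=
  ∃ (P : Fin 3 → H.Path) (v : V) (e : E), IsTheta P (Sum.inl v) (Sum.inr e)

end MultiHypergraph

/-- An oriented hypergraph: a hypergraph with an orientation `+1` or `-1` of each incidence. -/
structure OrientedHypergraph (V E : Type*) extends MultiHypergraph V E where
  orientation : toMultiHypergraph.Incidence → ℤˣ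

namespace OrientedHypergraph

variable {V E : Type*}

/-- The sign of a circle of length `k`: the product of `(-1) ^ k` and the orientations of its
`2 * k` incidences, that is, the product of the signs `-σ(i) σ(i')` of its adjacencies. -/
def circleSign (G : OrientedHypergraph V E) (C : G.toMultiHypergraph.Circle) : ℤˣ :=
  (-1) ^ C.length * ∏ j, G.orientation (C.inc j)

/-- An oriented hypergraph is balanced if all of its circles are positive. -/
def IsBalanced (G : OrientedHypergraph V E) : Prop :=
  ∀ C : G.toMultiHypergraph.Circle, G.circleSign C = 1

open Classical in
/-- The oriented hypergraph obtained by negating exactly the incidences in `S`. -/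
noncomputable def negate (G : OrientedHypergraph V E) (S : Set G.Incidence) :
    OrientedHypergraph V E where
  toMultiHypergraph := G.toMultiHypergraph
  orientation i := if i ∈ S then -G.orientation i else G.orientation i

/-- An oriented hypergraph is balanceable if some of its incidences can be negated so that the
result is balanced. -/
def IsBalanceable (G : OrientedHypergraph V E) : Prop :=
  ∃ S : Set G.Incidence, (G.negate S).IsBalanced

end OrientedHypergraph

/-!
Negating incidences turns the orientation into any prescribed `τ : Incidence → ±1`, so `G` is
balanceable if and only if some `τ` has product `(-1) ^ k` along every circle of length `k`.

The three pairs of paths of a cross-theta form three circles, the sum of whose lengths is the sum of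
the three odd lengths of the paths. The product of the three circle products is therefore `-1`,
although each incidence contributes its square to it.

Conversely, without cross-thetas no path off a circle `C` can lead from a vertex of `C` to an edge
of `C`. Hence the incidences of `C` are the cut around everything that can be reached from the
vertices of `C` off `C`, and every circle, being closed, crosses this cut an even number of times.
The conditions on `τ` form a linear system over `ZMod 2`, which is solvable unless some circles `C`
that together cover every incidence an even number `nᵢ` of times have odd total length `∑ k_C`. But
`∑ nᵢ ^ 2 = ∑ #(C ∩ D)` is divisible by `4`, and modulo `4` the even intersections of distinct
circles cancel in pairs, which leaves `∑ 2 * k_C`.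
-/

section EvenIntersections

open Finset

variable {ι α : Type*}

theorem sum_sum_modEq_sum_diag (F : Finset ι) {c : ι → ι → ℤ} (hsymm : ∀ s t, c s t = c t s)
    (heven : ∀ s t, Even (c s t)) : ∑ s ∈ F, ∑ t ∈ F, c s t ≡ ∑ s ∈ F, c s s [ZMOD 4] := by
  classical
  induction F using Finset.induction_on with
  | empty => rfl
  | insert a F ha ih =>
    obtain ⟨k, hk⟩ : Even (∑ t ∈ F, c a t) := even_sum _ fun t _ => heven a t
    have hcross : ∑ s ∈ F, c s a = ∑ t ∈ F, c a t := sum_congr rfl fun s _ => hsymm s a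
    simp only [sum_insert ha, sum_add_distrib, hcross]
    rw [Int.modEq_iff_dvd] at ih ⊢
    obtain ⟨m, hm⟩ := ih
    exact ⟨m - k, by linarith⟩

variable [DecidableEq α]

theorem sum_sum_card_inter (S : ι → Finset α) (F : Finset ι) :
    ∑ c ∈ F, ∑ d ∈ F, #(S c ∩ S d) = ∑ i ∈ F.biUnion S, #{c ∈ F | i ∈ S c} ^ 2 := by
  have hinter : ∀ c ∈ F, ∀ d, #(S c ∩ S d) =
      ∑ i ∈ F.biUnion S, (if i ∈ S c then 1 else 0) * (if i ∈ S d then 1 else 0) := fun c hc d => by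
    rw [card_eq_sum_ones, ← filter_mem_eq_inter, sum_filter,
      ← sum_subset (subset_biUnion_of_mem S hc) fun i _ hi => by simp [hi]]
    exact sum_congr rfl fun i hi => by simp [hi]
  calc ∑ c ∈ F, ∑ d ∈ F, #(S c ∩ S d)
      = ∑ c ∈ F, ∑ d ∈ F, ∑ i ∈ F.biUnion S,
          (if i ∈ S c then 1 else 0) * (if i ∈ S d then 1 else 0) :=
        sum_congr rfl fun c hc => sum_congr rfl fun d _ => hinter c hc d
    _ = ∑ i ∈ F.biUnion S, ∑ c ∈ F, ∑ d ∈ F,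
          (if i ∈ S c then 1 else 0) * (if i ∈ S d then 1 else 0) := by
        rw [sum_congr rfl fun c _ => sum_comm, sum_comm]
    _ = ∑ i ∈ F.biUnion S, #{c ∈ F | i ∈ S c} ^ 2 :=
        sum_congr rfl fun i _ => by rw [card_filter, sq, sum_mul_sum]

theorem even_sum_card_div_two {S : ι → Finset α} (hS : ∀ c d, Even #(S c ∩ S d)) {F : Finset ι}
    (hF : ∀ i, Even #{c ∈ F | i ∈ S c}) : Even (∑ c ∈ F, #(S c) / 2) := by
  have hmod : ∑ c ∈ F, ∑ d ∈ F, (#(S c ∩ S d) : ℤ) ≡ ∑ c ∈ F, (#(S c) : ℤ) [ZMOD 4] := by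
    simpa only [inter_self] using sum_sum_modEq_sum_diag F (c := fun c d => (#(S c ∩ S d) : ℤ))
      (fun c d => by rw [inter_comm]) fun c d => (hS c d).natCast
  have hsquares : (4 : ℤ) ∣ ∑ c ∈ F, ∑ d ∈ F, (#(S c ∩ S d) : ℤ) := by
    have : 4 ∣ ∑ i ∈ F.biUnion S, #{c ∈ F | i ∈ S c} ^ 2 :=
      dvd_sum fun i _ => pow_dvd_pow_of_dvd (hF i).two_dvd 2
    exact_mod_cast sum_sum_card_inter S F ▸ this
  have hhalves : ∑ c ∈ F, #(S c) = 2 * ∑ c ∈ F, #(S c) / 2 := by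
    rw [mul_sum]
    exact sum_congr rfl fun c _ => (Nat.two_mul_div_two_of_even (by simpa using hS c c)).symm
  have hfour : 4 ∣ ∑ c ∈ F, #(S c) := by
    exact_mod_cast hmod.dvd_iff.1 hsquares
  rw [even_iff_two_dvd]
  omega

theorem exists_sum_eq_of_relations (S : ι → Finset α) (f : ι → ZMod 2)
    (h : ∀ F : Finset ι, (∀ i, Even #{c ∈ F | i ∈ S c}) → ∑ c ∈ F, f c = 0) :
    ∃ x : α → ZMod 2, ∀ c, ∑ i ∈ S c, x i = f c := by
  let A : (ι →₀ ZMod 2) →ₗ[ZMod 2] (α →₀ ZMod 2) :=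
    Finsupp.linearCombination (ZMod 2) fun c => ∑ i ∈ S c, Finsupp.single i 1
  let K : (ι →₀ ZMod 2) →ₗ[ZMod 2] ZMod 2 := Finsupp.linearCombination (ZMod 2) f
  have hK : K ∈ (LinearMap.ker A).dualAnnihilator := by
    rw [Submodule.mem_dualAnnihilator]
    intro l hl
    have hone : ∀ c ∈ l.support, l c = 1 := fun c hc =>
      Fin.eq_one_of_ne_zero _ (Finsupp.mem_support_iff.1 hc)
    have hKl : K l = ∑ c ∈ l.support, f c :=
      (Finsupp.linearCombination_apply _ _).trans <| sum_congr rfl fun c hc => by simp [hone c hc]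
    rw [hKl]
    refine h _ fun i => ?_
    have hi : (A l) i = #{c ∈ l.support | i ∈ S c} := by
      rw [Finsupp.linearCombination_apply, Finsupp.sum, Finsupp.finsetSum_apply, card_filter,
        Nat.cast_sum]
      exact sum_congr rfl fun c hc => by
        simp [hone c hc, Finsupp.finsetSum_apply, Finsupp.single_apply]
    rwa [LinearMap.mem_ker.1 hl, Finsupp.zero_apply, eq_comm, ZMod.natCast_eq_zero_iff_even] at hi
  rw [← LinearMap.range_dualMap_eq_dualAnnihilator_ker] at hK
  obtain ⟨φ, hφ⟩ := hK
  refine ⟨fun i => φ (Finsupp.single i 1), fun c => ?_⟩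
  simpa [A, K] using LinearMap.congr_fun hφ (Finsupp.single c 1)

theorem exists_prod_eq_neg_one_pow_card_div_two {S : ι → Finset α}
    (hS : ∀ c d, Even #(S c ∩ S d)) :
    ∃ τ : α → ℤˣ, ∀ c, ∏ i ∈ S c, τ i = (-1) ^ (#(S c) / 2) := by
  obtain ⟨x, hx⟩ := exists_sum_eq_of_relations S (fun c => ((#(S c) / 2 : ℕ) : ZMod 2))
    fun F hF => by
      rw [← Nat.cast_sum, ZMod.natCast_eq_zero_iff_even]
      exact even_sum_card_div_two hS hF
  refine ⟨fun i => (-1) ^ x i, fun c => ?_⟩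
  have hprod (s : Finset α) : ∏ i ∈ s, (-1 : ℤˣ) ^ x i = (-1) ^ ∑ i ∈ s, x i := by
    induction s using Finset.induction_on with
    | empty => simp
    | insert a s ha ih => rw [prod_insert ha, sum_insert ha, ih, uzpow_add]
  rw [hprod, hx, uzpow_natCast]

end EvenIntersections

theorem natCast_add_eq_natCast_cases {n m j k : ℕ} (hm : m < n) (hj : j ≤ m) (hk : k ≤ n - m)
    (h : ((m + k : ℕ) : ZMod n) = j) : j = 0 ∧ k = n - m ∨ j = m ∧ k = 0 := by
  rw [ZMod.natCast_eq_natCast_iff', Nat.mod_eq_of_lt (hj.trans_lt hm)] at h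
  rcases Nat.eq_or_lt_of_le (show m + k ≤ n by omega) with hfull | hlt
  · rw [hfull, Nat.mod_self] at h
    omega
  · rw [Nat.mod_eq_of_lt hlt] at h
    omega

theorem exists_isPath_forall_mem_support {W β : Type*} {G : SimpleGraph W} {S : Set W} {f : W → β}
    {a b : W} {p : G.Walk a b} (hp : p.IsPath) (ha : a ∈ S) (hb : b ∈ S) (hab : f a ≠ f b) :
    ∃ a' ∈ S, ∃ b' ∈ S, f a' ≠ f b' ∧
      ∃ q : G.Walk a' b', q.IsPath ∧ ∀ c ∈ q.support, c ∈ S → c = a' ∨ c = b' := by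
  classical
  induction hn : p.length using Nat.strong_induction_on generalizing a b p with
  | _ n ih =>
    subst hn
    by_cases hinterior : ∀ c ∈ p.support, c ∈ S → c = a ∨ c = b
    · exact ⟨a, ha, b, hb, hab, p, hp, hinterior⟩
    · push Not at hinterior
      obtain ⟨c, hcp, hcS, hca, hcb⟩ := hinterior
      by_cases hac : f a = f c
      · exact ih _ (p.length_dropUntil_lt_length hcp hca) (hp.dropUntil hcp) hcS hb (hac ▸ hab) rfl
      · exact ih _ (p.length_takeUntil_lt_length hcp hcb) (hp.takeUntil hcp) ha hcS hac rfl

namespace MultiHypergraph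

open Finset

variable {V E : Type*} {H : MultiHypergraph V E}

section Joins

variable {i : H.Incidence} {a b c d : V ⊕ E}

theorem Incidence.Joins.symm (h : i.Joins a b) : i.Joins b a :=
  Or.symm (h.imp And.symm And.symm)

theorem Incidence.Joins.ne (h : i.Joins a b) : a ≠ b := by
  rcases h with ⟨rfl, rfl⟩ | ⟨rfl, rfl⟩ <;> simp

theorem Incidence.Joins.eq_or_swap (h : i.Joins a b) (h' : i.Joins c d) :
    a = c ∧ b = d ∨ a = d ∧ b = c := by
  rcases h with ⟨rfl, rfl⟩ | ⟨rfl, rfl⟩ <;> rcases h' with ⟨rfl, rfl⟩ | ⟨rfl, rfl⟩ <;> simp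

variable {n : ℕ} {elt : Fin (n + 1) → V ⊕ E} {inc : Fin n → H.Incidence}

theorem sum_coboundary (hjoins : ∀ j, (inc j).Joins (elt j.castSucc) (elt j.succ))
    {R : Type*} [CommRing R] [CharP R 2] (g : V ⊕ E → R) :
    ∑ j, (g (.inl (inc j).vertex) + g (.inr (inc j).edge)) = g (elt 0) + g (elt (Fin.last n)) := by
  have hterm (j) : g (.inl (inc j).vertex) + g (.inr (inc j).edge) =
      g (elt j.castSucc) + g (elt j.succ) := by
    rcases hjoins j with ⟨h₁, h₂⟩ | ⟨h₁, h₂⟩ <;> rw [h₁, h₂]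
    exact add_comm _ _
  have hshift := (Fin.sum_univ_castSucc fun j => g (elt j)).symm.trans (Fin.sum_univ_succ _)
  simp only [hterm, sum_add_distrib]
  grind

theorem natCast_length_eq_isLeft_add_isLeft
    (hjoins : ∀ j, (inc j).Joins (elt j.castSucc) (elt j.succ)) :
    (n : ZMod 2) =
      (if (elt 0).isLeft then 1 else 0) + if (elt (Fin.last n)).isLeft then 1 else 0 := by
  simpa using sum_coboundary hjoins fun a => (if a.isLeft then 1 else 0 : ZMod 2)

theorem injective_inc_of_injective_elt (hjoins : ∀ j, (inc j).Joins (elt j.castSucc) (elt j.succ))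
    (helt : elt.Injective) : inc.Injective := by
  intro j k hjk
  rcases (hjoins j).eq_or_swap (hjk ▸ hjoins k) with ⟨h, -⟩ | ⟨h₁, h₂⟩
  · exact Fin.castSucc_injective n (helt h)
  · have h₁ := congrArg Fin.val (helt h₁)
    have h₂ := congrArg Fin.val (helt h₂)
    simp only [Fin.val_castSucc, Fin.val_succ] at h₁ h₂
    omega

end Joins

namespace Path

/-- The end-points of the path `P` are `a`, where it starts, and `b`, where it stops. -/
def Connects (P : H.Path) (a b : V ⊕ E) : Prop :=
  P.elt 0 = a ∧ P.elt (Fin.last P.length) = b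

variable {P Q : H.Path} {a b : V ⊕ E}

theorem InternallyDisjoint.symm (h : P.InternallyDisjoint Q) : Q.InternallyDisjoint P :=
  ⟨h.2.1.symm, h.1.symm, h.2.2.symm⟩

theorem Connects.internallyDisjoint (hP : P.Connects a b) (hQ : Q.Connects a b)
    (helt : ∀ c ∈ P.elements, c ∈ Q.elements → c = a ∨ c = b)
    (hinc : Disjoint P.incidences Q.incidences) : P.InternallyDisjoint Q := by
  have hinterior {R : H.Path} (hR : R.Connects a b) {c} (hc : c ∈ R.interior) :
      c ∈ R.elements ∧ ¬(c = a ∨ c = b) := by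
    obtain ⟨j, hj₀, hj₁, rfl⟩ := hc
    rw [← hR.1, ← hR.2, R.elt_injective.eq_iff, R.elt_injective.eq_iff]
    exact ⟨⟨j, rfl⟩, not_or.2 ⟨hj₀, hj₁⟩⟩
  refine ⟨Set.disjoint_left.2 fun c hcP hcQ => ?_, Set.disjoint_left.2 fun c hcP hcQ => ?_, hinc⟩
  · exact (hinterior hP hcP).2 (helt c (hinterior hP hcP).1 hcQ)
  · exact (hinterior hQ hcQ).2 (helt c hcP (hinterior hQ hcQ).1)

/-- The path traversed backwards. -/
def reverse (P : H.Path) : H.Path where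
  length := P.length
  elt j := P.elt j.rev
  inc j := P.inc j.rev
  joins j := by simpa only [Fin.rev_castSucc, Fin.rev_succ] using (P.joins j.rev).symm
  elt_injective := P.elt_injective.comp Fin.rev_injective
  inc_injective := P.inc_injective.comp Fin.rev_injective

theorem elements_reverse (P : H.Path) : P.reverse.elements = P.elements :=
  Fin.rev_surjective.range_comp P.elt

theorem incidences_reverse (P : H.Path) : P.reverse.incidences = P.incidences :=
  Fin.rev_surjective.range_comp P.inc

theorem prod_reverse {M : Type*} [CommMonoid M] (P : H.Path) (τ : H.Incidence → M) :
    ∏ j, τ (P.reverse.inc j) = ∏ j, τ (P.inc j) :=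
  Equiv.prod_comp Fin.revPerm fun j => τ (P.inc j)

theorem Connects.reverse (h : P.Connects a b) : P.reverse.Connects b a :=
  ⟨(congrArg P.elt (Fin.rev_zero _)).trans h.2, (congrArg P.elt (Fin.rev_last _)).trans h.1⟩

theorem Connects.odd_length {v : V} {e : E} (h : P.Connects (.inl v) (.inr e)) :
    Odd P.length := by
  rw [← ZMod.natCast_ne_zero_iff_odd, natCast_length_eq_isLeft_add_isLeft P.joins, h.1, h.2]
  simp

end Path

section GraphAvoiding

/-- The simple graph on the vertices and edges of `H` in which two of them are adjacent when they
are joined by an incidence outside `T`. -/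
def graphAvoiding (T : Set H.Incidence) : SimpleGraph (V ⊕ E) where
  Adj a b := ∃ i ∉ T, i.Joins a b
  symm := ⟨fun _ _ ⟨i, hi, h⟩ => ⟨i, hi, h.symm⟩⟩
  loopless := ⟨fun _ ⟨_, _, h⟩ => h.ne rfl⟩

theorem exists_path_of_isPath {T : Set H.Incidence} {a b : V ⊕ E} {p : (graphAvoiding T).Walk a b}
    (hp : p.IsPath) : ∃ P : H.Path, P.Connects a b ∧ (∀ c ∈ P.elements, c ∈ p.support) ∧
      Disjoint P.incidences T := by
  choose inc hinc hjoins using fun j : Fin p.length => p.adj_getVert_succ j.isLt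
  have hinj : Function.Injective fun j : Fin (p.length + 1) => p.getVert j := fun j k h =>
    Fin.ext (hp.getVert_injOn (Nat.le_of_lt_succ j.isLt) (Nat.le_of_lt_succ k.isLt) h)
  refine ⟨⟨p.length, fun j => p.getVert j, inc, hjoins, hinj,
    injective_inc_of_injective_elt hjoins hinj⟩, ⟨p.getVert_zero, p.getVert_length⟩, ?_, ?_⟩
  · rintro _ ⟨j, rfl⟩
    exact p.getVert_mem_support j
  · rw [Set.disjoint_left]
    rintro _ ⟨j, rfl⟩
    exact hinc j

end GraphAvoiding

namespace Circle

variable {C : H.Circle}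

/-- The incidences of the circle. -/
def incidences (C : H.Circle) : Finset H.Incidence :=
  univ.map ⟨C.inc, C.inc_injective⟩

theorem mem_incidences {i : H.Incidence} : i ∈ C.incidences ↔ ∃ j, C.inc j = i := by
  simp [incidences]

theorem card_incidences (C : H.Circle) : #C.incidences = 2 * C.length := by
  simp [incidences]

theorem prod_incidences {M : Type*} [CommMonoid M] (C : H.Circle) (τ : H.Incidence → M) :
    ∏ i ∈ C.incidences, τ i = ∏ j, τ (C.inc j) :=
  prod_map _ _ _

/-- The vertices and edges of the circle. -/
def elements (C : H.Circle) : Set (V ⊕ E) := Set.range C.elt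

theorem mem_elements_of_mem_incidences {i : H.Incidence} (hi : i ∈ C.incidences) :
    .inl i.vertex ∈ C.elements ∧ .inr i.edge ∈ C.elements := by
  obtain ⟨j, rfl⟩ := mem_incidences.1 hi
  rcases C.joins j with ⟨h₁, h₂⟩ | ⟨h₁, h₂⟩ <;> rw [← h₁, ← h₂]
  exacts [⟨⟨_, rfl⟩, ⟨_, rfl⟩⟩, ⟨⟨_, rfl⟩, ⟨_, rfl⟩⟩]

section Cyclic

instance (C : H.Circle) : Fact (1 < 2 * C.length) :=
  ⟨by have := C.length_pos; omega⟩

/-- The element at position `z` of the circle, where positions are read cyclically. -/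
def cyclicElt (C : H.Circle) (z : ZMod (2 * C.length)) : V ⊕ E :=
  C.elt (Fin.castSucc ⟨z.val, z.val_lt⟩)

/-- The incidence after position `z` of the circle, where positions are read cyclically. -/
def cyclicInc (C : H.Circle) (z : ZMod (2 * C.length)) : H.Incidence :=
  C.inc ⟨z.val, z.val_lt⟩

theorem cyclicElt_injective : C.cyclicElt.Injective := fun _ _ h =>
  ZMod.val_injective _ (congrArg Fin.val (C.elt_injective h))

theorem cyclicInc_injective : C.cyclicInc.Injective := fun _ _ h =>
  ZMod.val_injective _ (congrArg Fin.val (C.inc_injective h))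

theorem cyclicElt_add_one (z : ZMod (2 * C.length)) :
    C.cyclicElt (z + 1) = C.elt (Fin.succ ⟨z.val, z.val_lt⟩) := by
  have hval : (z + 1).val = (z.val + 1) % (2 * C.length) := by rw [ZMod.val_add, ZMod.val_one]
  rcases (Nat.succ_le_of_lt z.val_lt).lt_or_eq with hlt | heq
  · exact congrArg C.elt (Fin.ext (hval.trans (Nat.mod_eq_of_lt hlt)))
  · have hlast : Fin.succ ⟨z.val, z.val_lt⟩ = Fin.last (2 * C.length) := Fin.ext heq
    have hzero : (z + 1).val = 0 := hval.trans (by rw [← Nat.succ_eq_add_one, heq, Nat.mod_self])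
    rw [hlast, ← C.closed]
    exact congrArg C.elt (Fin.ext hzero)

theorem joins_cyclic (z : ZMod (2 * C.length)) :
    (C.cyclicInc z).Joins (C.cyclicElt z) (C.cyclicElt (z + 1)) :=
  cyclicElt_add_one z ▸ C.joins _

theorem cyclicElt_mem_elements (z : ZMod (2 * C.length)) : C.cyclicElt z ∈ C.elements := ⟨_, rfl⟩

theorem cyclicInc_mem_incidences (z : ZMod (2 * C.length)) : C.cyclicInc z ∈ C.incidences :=
  mem_incidences.2 ⟨_, rfl⟩

theorem exists_cyclicElt_eq {a : V ⊕ E} (ha : a ∈ C.elements) : ∃ z, C.cyclicElt z = a := by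
  obtain ⟨j, rfl⟩ := ha
  induction j using Fin.lastCases with
  | last => exact ⟨0, C.closed ▸ congrArg C.elt (Fin.ext ZMod.val_zero)⟩
  | cast j => exact ⟨(j : ℕ), congrArg C.elt (Fin.ext (ZMod.val_natCast_of_lt j.isLt))⟩

/-- The path that runs along the circle from position `z` to position `z + m`. -/
def arc (C : H.Circle) (z : ZMod (2 * C.length)) (m : ℕ) (hm : m < 2 * C.length) : H.Path where
  length := m
  elt j := C.cyclicElt (z + (j : ℕ))
  inc j := C.cyclicInc (z + (j : ℕ))
  joins j := by simpa [add_assoc] using joins_cyclic (z + ((j : ℕ) : ZMod (2 * C.length)))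
  elt_injective j k h := Fin.ext <| CharP.natCast_injOn_Iio (ZMod (2 * C.length)) _
    (Set.mem_Iio.2 (by omega)) (Set.mem_Iio.2 (by omega))
    (add_left_cancel (cyclicElt_injective h))
  inc_injective j k h := Fin.ext <| CharP.natCast_injOn_Iio (ZMod (2 * C.length)) _
    (Set.mem_Iio.2 (by omega)) (Set.mem_Iio.2 (by omega))
    (add_left_cancel (cyclicInc_injective h))

theorem arc_connects (z : ZMod (2 * C.length)) {m : ℕ} (hm : m < 2 * C.length) :
    (C.arc z m hm).Connects (C.cyclicElt z) (C.cyclicElt (z + m)) :=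
  ⟨by simp [arc], by simp [arc]⟩

theorem elements_arc_subset (z : ZMod (2 * C.length)) {m : ℕ} (hm : m < 2 * C.length) :
    (C.arc z m hm).elements ⊆ C.elements := by
  rintro _ ⟨j, rfl⟩
  exact cyclicElt_mem_elements _

theorem incidences_arc_subset (z : ZMod (2 * C.length)) {m : ℕ} (hm : m < 2 * C.length) :
    (C.arc z m hm).incidences ⊆ C.incidences := by
  rintro _ ⟨j, rfl⟩
  exact cyclicInc_mem_incidences _

section ComplementaryArcs

variable {z : ZMod (2 * C.length)} {m : ℕ} (hm : m < 2 * C.length)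
  (hm' : 2 * C.length - m < 2 * C.length)

theorem eq_end_of_mem_elements_arcs {a : V ⊕ E} (ha : a ∈ (C.arc z m hm).elements)
    (ha' : a ∈ (C.arc (z + m) (2 * C.length - m) hm').elements) :
    a = C.cyclicElt z ∨ a = C.cyclicElt (z + m) := by
  obtain ⟨⟨j, hj⟩, rfl⟩ := ha
  obtain ⟨⟨k, hk⟩, hkj⟩ := ha'
  simp only [arc] at hj hk hkj ⊢
  have hcast : ((m + k : ℕ) : ZMod (2 * C.length)) = j := by
    simpa [add_assoc] using cyclicElt_injective hkj
  rcases natCast_add_eq_natCast_cases hm (by omega) (by omega) hcast with ⟨rfl, -⟩ | ⟨rfl, -⟩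
  · simp
  · simp

theorem disjoint_incidences_arcs : Disjoint (C.arc z m hm).incidences
    (C.arc (z + m) (2 * C.length - m) hm').incidences := by
  rw [Set.disjoint_left]
  rintro _ ⟨⟨j, hj⟩, rfl⟩ ⟨⟨k, hk⟩, hkj⟩
  simp only [arc] at hj hk hkj
  have hcast : ((m + k : ℕ) : ZMod (2 * C.length)) = j := by
    simpa [add_assoc] using cyclicInc_injective hkj
  have := natCast_add_eq_natCast_cases hm hj.le hk.le hcast
  omega

end ComplementaryArcs

theorem exists_internallyDisjoint_arcs {a b : V ⊕ E} (ha : a ∈ C.elements) (hb : b ∈ C.elements)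
    (hab : a ≠ b) : ∃ P Q : H.Path, P.Connects a b ∧ Q.Connects a b ∧ P.InternallyDisjoint Q ∧
      P.elements ∪ Q.elements ⊆ C.elements ∧ P.incidences ∪ Q.incidences ⊆ C.incidences := by
  obtain ⟨z, rfl⟩ := exists_cyclicElt_eq ha
  obtain ⟨w, rfl⟩ := exists_cyclicElt_eq hb
  obtain ⟨m, hm, rfl⟩ : ∃ m : ℕ, m < 2 * C.length ∧ z + (m : ZMod (2 * C.length)) = w :=
    ⟨(w - z).val, ZMod.val_lt _, by simp⟩
  have hm₀ : m ≠ 0 := by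
    rintro rfl
    simp at hab
  have hm' : 2 * C.length - m < 2 * C.length := by omega
  have hend : z + (m : ZMod (2 * C.length)) + (2 * C.length - m : ℕ) = z := by
    rw [add_assoc, ← Nat.cast_add, Nat.add_sub_cancel' hm.le, ZMod.natCast_self, add_zero]
  have hP : (C.arc z m hm).Connects _ _ := arc_connects z hm
  have hQ := (arc_connects (C := C) (z + (m : ZMod (2 * C.length))) hm').reverse
  rw [hend] at hQ
  refine ⟨_, _, hP, hQ, hP.internallyDisjoint hQ ?_ ?_, ?_, ?_⟩
  · rw [Path.elements_reverse]
    exact fun c => eq_end_of_mem_elements_arcs hm hm'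
  · rw [Path.incidences_reverse]
    exact disjoint_incidences_arcs hm hm'
  · rw [Path.elements_reverse]
    exact Set.union_subset (elements_arc_subset _ hm) (elements_arc_subset _ hm')
  · rw [Path.incidences_reverse]
    exact Set.union_subset (incidences_arc_subset _ hm) (incidences_arc_subset _ hm')

end Cyclic

theorem containsCrossTheta_of_ear {v : V} {e : E} (hv : .inl v ∈ C.elements)
    (he : .inr e ∈ C.elements) {R : H.Path} (hR : R.Connects (.inl v) (.inr e))
    (helt : ∀ c ∈ R.elements, c ∈ C.elements → c = .inl v ∨ c = .inr e)
    (hinc : Disjoint R.incidences C.incidences) : H.ContainsCrossTheta := by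
  obtain ⟨P, Q, hP, hQ, hPQ, hPQelt, hPQinc⟩ := exists_internallyDisjoint_arcs hv he (by simp)
  rw [Set.union_subset_iff] at hPQelt hPQinc
  have hRP : R.InternallyDisjoint P := hR.internallyDisjoint hP
    (fun c hc hcP => helt c hc (hPQelt.1 hcP)) (hinc.mono_right hPQinc.1)
  have hRQ : R.InternallyDisjoint Q := hR.internallyDisjoint hQ
    (fun c hc hcQ => helt c hc (hPQelt.2 hcQ)) (hinc.mono_right hPQinc.2)
  refine ⟨![P, Q, R], v, e, by simp, fun t => ?_, fun t => ?_, ?_⟩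
  · fin_cases t
    exacts [hP.1, hQ.1, hR.1]
  · fin_cases t
    exacts [hP.2, hQ.2, hR.2]
  · simp [Fin.forall_fin_succ, hPQ, hRP, hRQ, hPQ.symm, hRP.symm, hRQ.symm]

section NoCrossTheta

variable (hH : ¬H.ContainsCrossTheta)

include hH

theorem not_reachable_graphAvoiding {v : V} {e : E} (hv : .inl v ∈ C.elements)
    (he : .inr e ∈ C.elements) :
    ¬(graphAvoiding (C.incidences : Set H.Incidence)).Reachable (.inl v) (.inr e) := by
  intro hreach
  obtain ⟨p, hp⟩ := hreach.exists_isPath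
  obtain ⟨a, ha, b, hb, hab, q, hq, hqC⟩ :=
    exists_isPath_forall_mem_support (f := Sum.isLeft) hp hv he (by simp)
  obtain ⟨R, hR, hRq, hinc⟩ := exists_path_of_isPath hq
  have hends : ∀ c ∈ R.elements, c ∈ C.elements → c = a ∨ c = b := fun c hc => hqC c (hRq c hc)
  apply hH
  rcases a with v | e <;> rcases b with w | f
  · simp at hab
  · exact containsCrossTheta_of_ear ha hb hR hends hinc
  · rw [← R.elements_reverse] at hends
    rw [← R.incidences_reverse] at hinc
    exact containsCrossTheta_of_ear hb ha hR.reverse (fun c hc hcC => (hends c hc hcC).symm) hinc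
  · simp at hab

theorem exists_cut_eq_incidences (C : H.Circle) : ∃ U : Set (V ⊕ E), ∀ i : H.Incidence,
    i ∈ C.incidences ↔ ¬(.inl i.vertex ∈ U ↔ .inr i.edge ∈ U) := by
  let Γ := graphAvoiding (C.incidences : Set H.Incidence)
  refine ⟨{a | ∃ v, .inl v ∈ C.elements ∧ Γ.Reachable (.inl v) a}, fun i => ⟨fun hi => ?_, ?_⟩⟩
  · obtain ⟨hv, he⟩ := mem_elements_of_mem_incidences hi
    intro hiff
    obtain ⟨v, hv', hreach⟩ := hiff.1 ⟨i.vertex, hv, .rfl⟩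
    exact not_reachable_graphAvoiding hH hv' he hreach
  · contrapose!
    intro hi
    have hadj : Γ.Adj (.inl i.vertex) (.inr i.edge) := ⟨i, hi, .inl ⟨rfl, rfl⟩⟩
    exact exists_congr fun v => and_congr_right fun _ =>
      ⟨fun h => h.trans hadj.reachable, fun h => h.trans hadj.symm.reachable⟩

theorem even_card_incidences_inter [DecidableEq H.Incidence] (C D : H.Circle) :
    Even #(C.incidences ∩ D.incidences) := by
  classical
  obtain ⟨U, hU⟩ := exists_cut_eq_incidences hH C
  let g : V ⊕ E → ZMod 2 := fun a => if a ∈ U then 1 else 0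
  have hg (i : H.Incidence) :
      (if i ∈ C.incidences then 1 else 0) = g (.inl i.vertex) + g (.inr i.edge) := by
    by_cases hv : .inl i.vertex ∈ U <;> by_cases he : .inr i.edge ∈ U <;>
      simp [g, hU, hv, he, CharTwo.add_self_eq_zero]
  rw [inter_comm, ← filter_mem_eq_inter, ← ZMod.natCast_eq_zero_iff_even]
  calc (#{i ∈ D.incidences | i ∈ C.incidences} : ZMod 2)
      = ∑ j, (g (.inl (D.inc j).vertex) + g (.inr (D.inc j).edge)) := by
        simp only [natCast_card_filter, hg]
        exact sum_map _ _ _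
    _ = g (D.elt 0) + g (D.elt (Fin.last _)) := sum_coboundary D.joins g
    _ = 0 := by rw [D.closed, CharTwo.add_self_eq_zero]

end NoCrossTheta

end Circle

section CircleOfPaths

variable (M : Type*) [CommMonoid M] {n : ℕ} {elt : Fin (n + 1) → V ⊕ E} {inc : Fin n → H.Incidence}

theorem exists_circle_of_closed (hn : 0 < n)
    (hjoins : ∀ j, (inc j).Joins (elt j.castSucc) (elt j.succ))
    (hclosed : elt 0 = elt (Fin.last n)) (helt : (fun j : Fin n => elt j.castSucc).Injective)
    (hinc : inc.Injective) :
    ∃ C : H.Circle, n = 2 * C.length ∧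
      ∀ τ : H.Incidence → M, ∏ j, τ (C.inc j) = ∏ j, τ (inc j) := by
  have heven : Even n := by
    rw [← ZMod.natCast_eq_zero_iff_even, natCast_length_eq_isLeft_add_isLeft hjoins, hclosed,
      CharTwo.add_self_eq_zero]
  obtain ⟨k, rfl⟩ := heven.two_dvd
  exact ⟨⟨k, by omega, elt, inc, hjoins, hclosed, helt, hinc⟩, rfl, fun _ => rfl⟩

variable {P Q : H.Path} {a b : V ⊕ E}

/-- The vertices and edges met along `P` and then along `Q`, for a path `Q` that starts where `P`
stops, so that this common end-point is listed only once. -/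
def appendElt (P Q : H.Path) : Fin (P.length + Q.length + 1) → V ⊕ E :=
  (Fin.append (fun j => P.elt j.castSucc) Q.elt : Fin (P.length + (Q.length + 1)) → V ⊕ E)

theorem appendElt_natAdd (P Q : H.Path) (i : Fin (Q.length + 1)) :
    appendElt P Q (Fin.natAdd P.length i) = Q.elt i :=
  Fin.append_right _ _ i

theorem appendElt_castLE (hPQ : P.elt (Fin.last _) = Q.elt 0) (i : Fin (P.length + 1)) :
    appendElt P Q (i.castLE (by omega)) = P.elt i := by
  induction i using Fin.lastCases with
  | last => exact (appendElt_natAdd P Q 0).trans hPQ.symm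
  | cast i => exact Fin.append_left _ _ i

theorem joins_appendElt (hPQ : P.elt (Fin.last _) = Q.elt 0) (j : Fin (P.length + Q.length)) :
    (Fin.append P.inc Q.inc j).Joins (appendElt P Q j.castSucc) (appendElt P Q j.succ) := by
  induction j using Fin.addCases with
  | left i =>
    rw [Fin.append_left]
    exact (appendElt_castLE hPQ i.castSucc).symm ▸ (appendElt_castLE hPQ i.succ).symm ▸ P.joins i
  | right i =>
    rw [Fin.append_right]
    exact (appendElt_natAdd P Q i.castSucc).symm ▸ (appendElt_natAdd P Q i.succ).symm ▸ Q.joins i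

theorem injective_appendElt_castSucc (hP : P.Connects a b) (hQ : Q.Connects b a)
    (hPQ : Disjoint P.interior Q.elements) :
    (fun j : Fin (P.length + Q.length) => appendElt P Q j.castSucc).Injective := by
  have hcastSucc : (fun j : Fin (P.length + Q.length) => appendElt P Q j.castSucc) =
      Fin.append (fun j => P.elt j.castSucc) fun j => Q.elt j.castSucc := by
    funext j
    induction j using Fin.addCases with
    | left i =>
      rw [Fin.append_left]
      exact Fin.append_left _ Q.elt i
    | right i =>
      rw [Fin.append_right]
      exact appendElt_natAdd P Q i.castSucc
  rw [hcastSucc, Fin.append_injective_iff]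
  refine ⟨P.elt_injective.comp (Fin.castSucc_injective _),
    Q.elt_injective.comp (Fin.castSucc_injective _), fun i j hij => ?_⟩
  by_cases hi : i.castSucc = 0
  · rw [hi, hP.1, ← hQ.2] at hij
    exact Fin.castSucc_ne_last j (Q.elt_injective hij).symm
  · exact Set.disjoint_left.1 hPQ ⟨_, hi, Fin.castSucc_ne_last i, rfl⟩ ⟨_, hij.symm⟩

theorem exists_circle_of_closing_path (hP : P.Connects a b) (hQ : Q.Connects b a) (hab : a ≠ b)
    (helt : Disjoint P.interior Q.elements) (hinc : Disjoint P.incidences Q.incidences) :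
    ∃ C : H.Circle, P.length + Q.length = 2 * C.length ∧
      ∀ τ : H.Incidence → M, ∏ j, τ (C.inc j) = (∏ j, τ (P.inc j)) * ∏ j, τ (Q.inc j) := by
  have hPQ : P.elt (Fin.last _) = Q.elt 0 := hP.2.trans hQ.1.symm
  have hpos : P.length ≠ 0 := fun h =>
    hab (hP.1.symm.trans ((congrArg P.elt (Fin.ext h.symm)).trans hP.2))
  have hclosed : appendElt P Q 0 = appendElt P Q (Fin.last _) :=
    (appendElt_castLE hPQ 0).trans
      (hP.1.trans (hQ.2.symm.trans (appendElt_natAdd P Q (Fin.last _)).symm))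
  have hinj : (Fin.append P.inc Q.inc).Injective :=
    Fin.append_injective_iff.2 ⟨P.inc_injective, Q.inc_injective, fun i j h =>
      Set.disjoint_left.1 hinc ⟨i, rfl⟩ ⟨j, h.symm⟩⟩
  obtain ⟨C, hlength, hprod⟩ := exists_circle_of_closed M (by omega) (joins_appendElt hPQ) hclosed
    (injective_appendElt_castSucc hP hQ helt) hinj
  refine ⟨C, hlength, fun τ => (hprod τ).trans ?_⟩
  simp only [Fin.prod_univ_add, Fin.append_left, Fin.append_right]

theorem exists_circle_of_internallyDisjoint (hP : P.Connects a b) (hQ : Q.Connects a b)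
    (hab : a ≠ b) (hPQ : P.InternallyDisjoint Q) :
    ∃ C : H.Circle, P.length + Q.length = 2 * C.length ∧
      ∀ τ : H.Incidence → M, ∏ j, τ (C.inc j) = (∏ j, τ (P.inc j)) * ∏ j, τ (Q.inc j) := by
  obtain ⟨C, hlength, hprod⟩ := exists_circle_of_closing_path M hP hQ.reverse hab
    (Q.elements_reverse ▸ hPQ.1) (Q.incidences_reverse ▸ hPQ.2.2)
  exact ⟨C, hlength, fun τ => (hprod τ).trans (by rw [Q.prod_reverse])⟩

end CircleOfPaths

end MultiHypergraph

namespace OrientedHypergraph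

variable {V E : Type*}

theorem isBalanced_iff_prod_eq {G : OrientedHypergraph V E} :
    G.IsBalanced ↔ ∀ C : G.toMultiHypergraph.Circle,
      ∏ j, G.orientation (C.inc j) = (-1) ^ C.length :=
  forall_congr' fun C => by
    rw [circleSign, mul_eq_one_iff_inv_eq, Int.units_inv_eq_self, eq_comm]

theorem orientation_negate_setOf_ne (G : OrientedHypergraph V E) (τ : G.Incidence → ℤˣ) :
    (G.negate {i | G.orientation i ≠ τ i}).orientation = τ := by
  funext i
  by_cases hi : G.orientation i = τ i
  · simp [negate, hi]
  · simp [negate, Int.units_ne_iff_eq_neg.1 hi]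

theorem isBalanceable_iff_exists_prod_eq {G : OrientedHypergraph V E} :
    G.IsBalanceable ↔ ∃ τ : G.Incidence → ℤˣ, ∀ C : G.toMultiHypergraph.Circle,
      ∏ j, τ (C.inc j) = (-1) ^ C.length := by
  constructor
  · rintro ⟨S, hS⟩
    exact ⟨_, (isBalanced_iff_prod_eq (G := G.negate S)).1 hS⟩
  · rintro ⟨τ, hτ⟩
    exact ⟨_, isBalanced_iff_prod_eq.2 ((G.orientation_negate_setOf_ne τ).symm ▸ hτ)⟩

theorem isBalanceable_of_not_containsCrossTheta {G : OrientedHypergraph V E}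
    (hG : ¬G.toMultiHypergraph.ContainsCrossTheta) : G.IsBalanceable := by
  classical
  obtain ⟨τ, hτ⟩ := exists_prod_eq_neg_one_pow_card_div_two
    (MultiHypergraph.Circle.even_card_incidences_inter hG)
  refine isBalanceable_iff_exists_prod_eq.2 ⟨τ, fun C => ?_⟩
  rw [← C.prod_incidences, hτ, C.card_incidences, Nat.mul_div_cancel_left _ two_pos]

theorem not_isBalanceable_of_containsCrossTheta {G : OrientedHypergraph V E}
    (hG : G.toMultiHypergraph.ContainsCrossTheta) : ¬G.IsBalanceable := by
  rw [isBalanceable_iff_exists_prod_eq]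
  rintro ⟨τ, hτ⟩
  obtain ⟨P, v, e, hne, hfirst, hlast, hdisj⟩ := hG
  have hP (t) : (P t).Connects (.inl v) (.inr e) := ⟨hfirst t, hlast t⟩
  have hpair {s t} (hst : s ≠ t) : ∃ k, (P s).length + (P t).length = 2 * k ∧
      (∏ j, τ ((P s).inc j)) * ∏ j, τ ((P t).inc j) = (-1) ^ k := by
    obtain ⟨C, hlength, hprod⟩ :=
      MultiHypergraph.exists_circle_of_internallyDisjoint ℤˣ (hP s) (hP t) hne (hdisj s t hst)
    exact ⟨C.length, hlength, hprod τ ▸ hτ C⟩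
  obtain ⟨k₀₁, hlength₀₁, hprod₀₁⟩ := hpair (show (0 : Fin 3) ≠ 1 by decide)
  obtain ⟨k₀₂, hlength₀₂, hprod₀₂⟩ := hpair (show (0 : Fin 3) ≠ 2 by decide)
  obtain ⟨k₁₂, hlength₁₂, hprod₁₂⟩ := hpair (show (1 : Fin 3) ≠ 2 by decide)
  have hodd : Odd (k₀₁ + k₀₂ + k₁₂) := by
    have := ((hP 0).odd_length.add_odd (hP 1).odd_length).add_odd (hP 2).odd_length
    rwa [show k₀₁ + k₀₂ + k₁₂ = (P 0).length + (P 1).length + (P 2).length by omega]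
  have heven : (-1 : ℤˣ) ^ (k₀₁ + k₀₂ + k₁₂) = 1 := by
    rw [pow_add, pow_add, ← hprod₀₁, ← hprod₀₂, ← hprod₁₂,
      mul_mul_mul_comm (∏ j, τ ((P 0).inc j)), Int.units_mul_self, one_mul, Int.units_mul_self]
  rw [hodd.neg_one_pow] at heven
  exact absurd heven (by decide)

end OrientedHypergraph

theorem mainTheorem5_general {V E : Type*} (G : OrientedHypergraph V E) :
    G.IsBalanceable ↔ ¬G.toMultiHypergraph.ContainsCrossTheta :=
  ⟨fun h hG => OrientedHypergraph.not_isBalanceable_of_containsCrossTheta hG h,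
    OrientedHypergraph.isBalanceable_of_not_containsCrossTheta⟩

theorem mainTheorem5 {V E : Type*} [Finite V] [Finite E] (G : OrientedHypergraph V E) :
    G.IsBalanceable ↔ ¬ G.toMultiHypergraph.ContainsCrossTheta :=
  mainTheorem5_general G
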